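/- For a finite set $A$ of positive integers, let $\Sigma(A) = \left\{ \sum_{s \in S} s : S \subseteq A \right\}$ be its set of subset sums, and write $[n] = \{1, 2, \dots, n\}$. A homogeneous progression of length $k$ is an arithmetic progression $a, a+d, \dots, a+(k-1)d$ of $k$ terms whose common difference $d \geq 1$ divides $a$ and, hence, every term. There is an absolute constant $C > 0$ such that, for every $n$ and every $A \subseteq [n]$ with $|A| \geq C\sqrt{n}$, the set $\Sigma(A)$ contains a homogeneous progression of length $n$. -/

import Mathlib

/-- The set `Σ(A)` of subset sums of a finite set `A` of natural numbers: all integers of the form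
`∑ s ∈ S, s` with `S ⊆ A` (the empty sum `0` is included). -/
def subsetSums (A : Finset ℕ) : Set ℕ :=
  {x | ∃ S : Finset ℕ, S ⊆ A ∧ ∑ s ∈ S, s = x}

/-- `P` is a homogeneous progression of length `k`: it consists of the `k` terms
`a, a + d, …, a + (k - 1) d` of an arithmetic progression whose common difference `d ≥ 1`
divides `a` (hence every term). -/
def IsHomogeneousProgression (P : Finset ℕ) (k : ℕ) : Prop :=
  ∃ a d : ℕ, 0 < d ∧ d ∣ a ∧ P = (Finset.range k).image (fun i => a + i * d)

/-! Call `A` in `[1, l]` robust if, after any few deletions, it still has at least `q ~ √l`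
elements, gcd 1 and an element above `l / 2`. The proof is a dichotomy between robust sets and a
passage to half the scale.

Robust case: the sums of a growing subset of `A` modulo `Y` are enlarged greedily. If `B` is the
current set of sums and many signed sums of a few remaining elements exist, then some translate of
`B` leaves `B` substantially, and by subadditivity so does a translate by a single element
(`exists_shiftExcess_ge`). Signed sums are plentiful because they grow quadratically in the
integers, then linearly modulo `Y` (`Rich.exists_nsmul_card_ge`). So `√|B|` grows by order `l / √Y`
per step, and `O(Y / l)` elements reach every residue. Disjoint blocks of this kind give a long
progression of some step `Y`, and one further block modulo that `Y` fills in an interval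
(`Robust.exists_interval`).

Otherwise, a few deletions leave a set with a common factor or inside `[1, l / 2]`; dividing by the
gcd if needed halves `l`, and homogeneity survives multiplying back. The deletions, of order `√l + n
/ l` per scale, sum to `O(√n)` because `l ≥ |A| ≥ √n` throughout (`hasHomogeneous_of_card`). -/

open scoped Pointwise

namespace SubsetSumProgression

/-! ### Translates leaving a finite set -/

section ShiftExcess

variable {G : Type*} [AddCommGroup G] [DecidableEq G]

/-- The number of elements gained by a finite set `B` when its translate by `x` is adjoined. -/
def shiftExcess (B : Finset G) (x : G) : ℕ := ((x +ᵥ B) \ B).card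

lemma shiftExcess_zero (B : Finset G) : shiftExcess B 0 = 0 := by
  simp [shiftExcess]

lemma shiftExcess_neg (B : Finset G) (x : G) : shiftExcess B (-x) = shiftExcess B x := by
  unfold shiftExcess
  have h1 : ((-x +ᵥ B) \ B).card = (B \ (x +ᵥ B)).card := by
    have h : (x +ᵥ ((-x +ᵥ B) \ B)) = B \ (x +ᵥ B) := by
      rw [Finset.vadd_finset_sdiff, vadd_vadd]; simp
    rw [← h, Finset.card_vadd_finset]
  have h2 := Finset.card_sdiff_add_card_inter (x +ᵥ B) B
  have h3 := Finset.card_sdiff_add_card_inter B (x +ᵥ B)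
  rw [Finset.inter_comm, Finset.card_vadd_finset] at h2
  omega

lemma shiftExcess_add_le (B : Finset G) (x y : G) :
    shiftExcess B (x + y) ≤ shiftExcess B x + shiftExcess B y := by
  unfold shiftExcess
  have h : ((x + y) +ᵥ B) \ B ⊆ ((x +ᵥ B) \ B) ∪ (x +ᵥ ((y +ᵥ B) \ B)) := by
    intro z hz
    rw [Finset.vadd_finset_sdiff, vadd_vadd]
    simp only [Finset.mem_union, Finset.mem_sdiff] at hz ⊢
    tauto
  refine (Finset.card_le_card h).trans ((Finset.card_union_le _ _).trans ?_)
  rw [Finset.card_vadd_finset]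

lemma shiftExcess_le_of_mem_nsmul {B S : Finset G} {m : ℕ} (h : ∀ a ∈ S, shiftExcess B a ≤ m)
    (k : ℕ) {x : G} (hx : x ∈ k • S) : shiftExcess B x ≤ k * m := by
  induction k generalizing x with
  | zero =>
    simp only [zero_nsmul, Finset.mem_zero] at hx
    simp [hx, shiftExcess_zero]
  | succ k ih =>
    rw [succ_nsmul, Finset.mem_add] at hx
    obtain ⟨y, hy, z, hz, rfl⟩ := hx
    have := shiftExcess_add_le B y z
    have := ih hy
    have := h z hz
    linarith [add_one_mul k m]

/-- Averaging: the overlaps of `B` with its translates by all `x` total at most `|B|²`, since each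
pair in `B × B` determines its difference. Over `2|B|` shifts the mean overlap is at most `|B| / 2`.
-/
lemma exists_card_le_two_mul_shiftExcess {B W : Finset G} (hB : B.Nonempty)
    (hW : 2 * B.card ≤ W.card) : ∃ x ∈ W, B.card ≤ 2 * shiftExcess B x := by
  by_contra! hcon
  have hinter : ∀ x ∈ W, B.card + 1 ≤ 2 * ((x +ᵥ B) ∩ B).card := by
    intro x hx
    have h1 := hcon x hx
    have h2 := Finset.card_sdiff_add_card_inter (x +ᵥ B) B
    rw [Finset.card_vadd_finset] at h2
    unfold shiftExcess at h1
    omega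
  have hsum : ∑ x ∈ W, ((x +ᵥ B) ∩ B).card ≤ B.card * B.card := by
    rw [← Finset.card_sigma, ← Finset.card_product]
    refine Finset.card_le_card_of_injOn (fun p => (p.2 - p.1, p.2)) ?_ ?_
    · rintro ⟨x, y⟩ hp
      simp only [Finset.coe_sigma, Set.mem_sigma_iff, Finset.mem_coe, Finset.mem_inter,
        Finset.mem_vadd_finset] at hp
      obtain ⟨-, ⟨b, hb, rfl⟩, hy⟩ := hp
      simp only [vadd_eq_add] at hy
      simp [hb, hy]
    · rintro ⟨x, y⟩ - ⟨x', y'⟩ - h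
      simp only [Prod.mk.injEq] at h
      obtain ⟨h1, rfl⟩ := h
      simp_all
  have h1 : W.card * (B.card + 1) ≤ 2 * (B.card * B.card) := by
    calc W.card * (B.card + 1) = ∑ x ∈ W, (B.card + 1) := by simp
      _ ≤ ∑ x ∈ W, 2 * ((x +ᵥ B) ∩ B).card := Finset.sum_le_sum hinter
      _ = 2 * ∑ x ∈ W, ((x +ᵥ B) ∩ B).card := by rw [Finset.mul_sum]
      _ ≤ _ := by omega
  have h2 := hB.card_pos
  nlinarith

lemma exists_shiftExcess_ge {B S : Finset G} (hB : B.Nonempty) {k : ℕ}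
    (hS : S.Nonempty) (hk : 2 * B.card ≤ (k • S).card) :
    ∃ a ∈ S, B.card ≤ 2 * (k * shiftExcess B a) := by
  obtain ⟨x, hx, hxB⟩ := exists_card_le_two_mul_shiftExcess hB hk
  obtain ⟨a, ha, hmax⟩ := Finset.exists_max_image S (shiftExcess B) hS
  exact ⟨a, ha, hxB.trans (Nat.mul_le_mul_left 2 (shiftExcess_le_of_mem_nsmul hmax k hx))⟩

lemma card_union_vadd (B : Finset G) (x : G) :
    (B ∪ (x +ᵥ B)).card = B.card + shiftExcess B x := by
  unfold shiftExcess
  rw [← Finset.union_sdiff_self_eq_union, Finset.card_union_of_disjoint Finset.disjoint_sdiff]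

end ShiftExcess

/-! ### Linear growth of multiples of a symmetric generating set -/

section Generation

variable {G : Type*} [AddCommGroup G] [DecidableEq G]

lemma nsmul_subset_nsmul_of_le {S : Finset G} (h0 : 0 ∈ S) {a b : ℕ} (h : a ≤ b) :
    a • S ⊆ b • S := Finset.nsmul_subset_nsmul_right h0 h

lemma neg_mem_nsmul {S : Finset G} (hneg : ∀ x ∈ S, -x ∈ S) (k : ℕ) {x : G} (hx : x ∈ k • S) :
    -x ∈ k • S := by
  induction k generalizing x with
  | zero => simpa using hx
  | succ k ih =>
    rw [succ_nsmul, Finset.mem_add] at hx ⊢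
    obtain ⟨y, hy, z, hz, rfl⟩ := hx
    exact ⟨-y, ih hy, -z, hneg z hz, by abel⟩

lemma nsmul_eq_univ_of_succ_subset [Fintype G] {S : Finset G} (h0 : 0 ∈ S)
    (hneg : ∀ x ∈ S, -x ∈ S) (hgen : AddSubgroup.closure (S : Set G) = ⊤) {j : ℕ}
    (h : (j + 1) • S ⊆ j • S) : j • S = Finset.univ := by
  have hstep : ∀ m, (j + m) • S ⊆ j • S := by
    intro m
    induction m with
    | zero => simp
    | succ m ih =>
      rw [← add_assoc, succ_nsmul]
      refine (Finset.add_subset_add_right ih).trans ?_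
      rw [← succ_nsmul]; exact h
  rw [Finset.eq_univ_iff_forall]
  intro x
  have hx : x ∈ AddSubgroup.closure (S : Set G) := by rw [hgen]; trivial
  induction hx using AddSubgroup.closure_induction with
  | mem x hx =>
    refine h (nsmul_subset_nsmul_of_le h0 (Nat.le_add_left 1 j) ?_)
    simpa using hx
  | zero => exact nsmul_subset_nsmul_of_le h0 (Nat.zero_le j) (by simp)
  | add x y _ _ hx hy =>
    refine hstep j ?_
    rw [add_nsmul]
    exact Finset.add_mem_add hx hy
  | neg x _ hx => exact neg_mem_nsmul hneg j hx

/-- Multiples of a symmetric generating set grow linearly until they fill the group. -/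
lemma nsmul_eq_univ_or_le_card [Fintype G] {S : Finset G} (h0 : 0 ∈ S)
    (hneg : ∀ x ∈ S, -x ∈ S) (hgen : AddSubgroup.closure (S : Set G) = ⊤) (k u : ℕ) :
    ((2 * k + 1) * u + k) • S = Finset.univ ∨
      (u + 1) * (k • S).card ≤ (((2 * k + 1) * u + k) • S).card := by
  rw [or_iff_not_imp_left]
  intro hne
  -- Multiples increase strictly until they fill the group, so each block of `2k + 1` steps supplies
  -- a point at distance over `2k` from all earlier ones; the translates of `k • S` by these points
  -- are then disjoint.
  have hnew : ∀ i : ℕ, ∃ x, i ≤ u → x ∈ ((2 * k + 1) * i) • S ∧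
      ∀ j < i, x ∉ ((2 * k + 1) * j + 2 * k) • S := by
    intro i
    by_cases hi : i ≤ u
    swap
    · exact ⟨0, fun h => absurd h hi⟩
    rcases Nat.eq_zero_or_pos i with rfl | hpos
    · exact ⟨0, fun _ => ⟨by simp, by simp⟩⟩
    have hns : ¬ (((2 * k + 1) * (i - 1) + 2 * k) + 1) • S ⊆
        ((2 * k + 1) * (i - 1) + 2 * k) • S := by
      intro hsub
      have huniv := nsmul_eq_univ_of_succ_subset h0 hneg hgen hsub
      apply hne
      rw [← Finset.univ_subset_iff, ← huniv]
      apply nsmul_subset_nsmul_of_le h0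
      obtain ⟨i, rfl⟩ : ∃ i', i = i' + 1 := ⟨i - 1, by omega⟩
      have := Nat.mul_le_mul_left (2 * k + 1) hi
      simp only [Nat.add_sub_cancel]
      linarith
    rw [Finset.not_subset] at hns
    obtain ⟨x, hx, hx'⟩ := hns
    refine ⟨x, fun _ => ⟨?_, ?_⟩⟩
    · convert hx using 2
      obtain ⟨i, rfl⟩ : ∃ i', i = i' + 1 := ⟨i - 1, by omega⟩
      simp only [Nat.add_sub_cancel]
      ring
    · intro j hj hmem
      apply hx'
      refine nsmul_subset_nsmul_of_le h0 ?_ hmem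
      have : j ≤ i - 1 := by omega
      gcongr
  choose x hx using hnew
  have hdisj : ∀ i ∈ Finset.range (u + 1), ∀ j ∈ Finset.range (u + 1), j < i →
      Disjoint (x i +ᵥ k • S) (x j +ᵥ k • S) := by
    intro i hi j hj hji
    rw [Finset.disjoint_left]
    intro z hz hz'
    rw [Finset.mem_vadd_finset] at hz hz'
    obtain ⟨a, ha, rfl⟩ := hz
    obtain ⟨b, hb, hab⟩ := hz'
    simp only [Finset.mem_range] at hi hj
    apply (hx i (by omega)).2 j hji
    have h1 : x i = x j + (b + -a) := by
      simp only [vadd_eq_add] at hab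
      rw [← add_assoc, hab]; abel
    rw [h1, show (2 * k + 1) * j + 2 * k = (2 * k + 1) * j + (k + k) by ring, add_nsmul,
      show (k + k) • S = k • S + k • S from add_nsmul S k k]
    exact Finset.add_mem_add (hx j (by omega)).1
      (Finset.add_mem_add hb (neg_mem_nsmul hneg k ha))
  have hpd : Set.PairwiseDisjoint (↑(Finset.range (u + 1))) (fun i => x i +ᵥ k • S) := by
    intro i hi j hj hij
    rcases lt_or_gt_of_ne hij with h | h
    · exact (hdisj j hj i hi h).symm
    · exact hdisj i hi j hj h
  calc (u + 1) * (k • S).card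
      = ((Finset.range (u + 1)).biUnion (fun i => x i +ᵥ k • S)).card := by
        rw [Finset.card_biUnion hpd]
        simp
    _ ≤ _ := by
        apply Finset.card_le_card
        intro z hz
        simp only [Finset.mem_biUnion, Finset.mem_range, Finset.mem_vadd_finset] at hz
        obtain ⟨i, hi, a, ha, rfl⟩ := hz
        rw [add_nsmul]
        refine Finset.add_mem_add ?_ ha
        exact nsmul_subset_nsmul_of_le h0 (Nat.mul_le_mul_left _ (by omega)) (hx i (by omega)).1

end Generation

/-! ### Quadratic growth of signed sums in the integers -/

section SymmetricSet

/-- The symmetric set `{0} ∪ R ∪ -R`, viewed in `G`. -/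
def symSet (G : Type*) [AddCommGroupWithOne G] [DecidableEq G] (R : Finset ℕ) : Finset G :=
  insert 0 (R.image (fun a : ℕ => (a : G)) ∪ R.image (fun a : ℕ => -(a : G)))

variable {G : Type*} [AddCommGroupWithOne G] [DecidableEq G] {R : Finset ℕ}

lemma mem_symSet {x : G} : x ∈ symSet G R ↔ x = 0 ∨ ∃ a ∈ R, x = a ∨ x = -a := by
  simp only [symSet, Finset.mem_insert, Finset.mem_union, Finset.mem_image]
  constructor
  · rintro (h | ⟨a, ha, rfl⟩ | ⟨a, ha, rfl⟩)
    · exact Or.inl h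
    · exact Or.inr ⟨a, ha, Or.inl rfl⟩
    · exact Or.inr ⟨a, ha, Or.inr rfl⟩
  · rintro (h | ⟨a, ha, rfl | rfl⟩)
    · exact Or.inl h
    · exact Or.inr (Or.inl ⟨a, ha, rfl⟩)
    · exact Or.inr (Or.inr ⟨a, ha, rfl⟩)

lemma zero_mem_symSet : (0 : G) ∈ symSet G R := mem_symSet.2 (Or.inl rfl)

lemma natCast_mem_symSet {a : ℕ} (ha : a ∈ R) : (a : G) ∈ symSet G R :=
  mem_symSet.2 (Or.inr ⟨a, ha, Or.inl rfl⟩)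

lemma neg_mem_symSet (x : G) (hx : x ∈ symSet G R) : -x ∈ symSet G R := by
  rw [mem_symSet] at hx ⊢
  rcases hx with rfl | ⟨a, ha, rfl | rfl⟩
  · simp
  · exact Or.inr ⟨a, ha, Or.inr rfl⟩
  · exact Or.inr ⟨a, ha, Or.inl (neg_neg _)⟩

lemma image_symSet_int (r : ℕ) (R : Finset ℕ) :
    (symSet ℤ R).image (Int.castAddHom (ZMod r)) = symSet (ZMod r) R := by
  ext x
  simp only [Finset.mem_image, mem_symSet]
  constructor
  · rintro ⟨y, rfl | ⟨a, ha, rfl | rfl⟩, rfl⟩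
    · simp
    · exact Or.inr ⟨a, ha, by simp⟩
    · exact Or.inr ⟨a, ha, by simp⟩
  · rintro (rfl | ⟨a, ha, rfl | rfl⟩)
    · exact ⟨0, by simp⟩
    · exact ⟨a, Or.inr ⟨a, ha, Or.inl rfl⟩, by simp⟩
    · exact ⟨-a, Or.inr ⟨a, ha, Or.inr rfl⟩, by simp⟩

lemma closure_symSet_eq_top (r : ℕ) (hgcd : R.gcd id = 1) :
    AddSubgroup.closure (symSet (ZMod r) R : Set (ZMod r)) = ⊤ := by
  set H := AddSubgroup.closure (symSet (ZMod r) R : Set (ZMod r)) with hH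
  obtain ⟨g, hg⟩ := Int.subgroup_cyclic (H.comap (Int.castAddHom (ZMod r)))
  have hdvd : ∀ a ∈ R, g ∣ (a : ℤ) := by
    intro a ha
    have : (a : ℤ) ∈ H.comap (Int.castAddHom (ZMod r)) := by
      rw [AddSubgroup.mem_comap]
      apply AddSubgroup.subset_closure
      simpa using natCast_mem_symSet ha
    rw [hg, AddSubgroup.mem_closure_singleton] at this
    obtain ⟨n, hn⟩ := this
    exact ⟨n, by rw [← hn, smul_eq_mul, mul_comm]⟩
  have hone : g.natAbs ∣ 1 := by
    rw [← hgcd]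
    refine Finset.dvd_gcd fun a ha => ?_
    have := Int.natAbs_dvd_natAbs.2 (hdvd a ha)
    simpa using this
  have h1 : (1 : ℤ) ∈ H.comap (Int.castAddHom (ZMod r)) := by
    rw [hg, AddSubgroup.mem_closure_singleton]
    have : g ∣ 1 := by
      rw [← Int.natAbs_dvd_natAbs]; simpa using hone
    obtain ⟨n, hn⟩ := this
    exact ⟨n, by rw [smul_eq_mul, mul_comm, ← hn]⟩
  rw [eq_top_iff]
  intro x _
  obtain ⟨z, rfl⟩ := ZMod.intCast_surjective x
  have : z • (1 : ℤ) ∈ H.comap (Int.castAddHom (ZMod r)) := AddSubgroup.zsmul_mem _ h1 z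
  simpa using this

lemma abs_le_of_mem_nsmul_symSet {r : ℕ} (hr : ∀ a ∈ R, a ≤ r) (k : ℕ) {x : ℤ}
    (hx : x ∈ k • symSet ℤ R) : |x| ≤ k * r := by
  induction k generalizing x with
  | zero => simp_all
  | succ k ih =>
    rw [succ_nsmul, Finset.mem_add] at hx
    obtain ⟨y, hy, z, hz, rfl⟩ := hx
    have h1 := ih hy
    have h2 : |z| ≤ r := by
      rw [mem_symSet] at hz
      rcases hz with rfl | ⟨a, ha, rfl | rfl⟩
      · simp
      · simpa using hr a ha
      · simpa using hr a ha
    have := abs_add_le y z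
    push_cast
    linarith [add_one_mul (k : ℤ) r]

/-- Each residue modulo `r` lifts to a signed sum, and adding `0, r, …, jr` to the lift gives `j +
1` distinct integers in its class. -/
lemma mul_card_le_card_nsmul_symSet {r : ℕ} (hr : r ∈ R) (hr0 : 0 < r) (k j : ℕ) :
    (j + 1) * (k • symSet (ZMod r) R).card ≤ ((k + j) • symSet ℤ R).card := by
  have hlift : ∀ y : ZMod r, ∃ z : ℤ, y ∈ k • symSet (ZMod r) R →
      z ∈ k • symSet ℤ R ∧ (z : ZMod r) = y := by
    intro y
    by_cases hy : y ∈ k • symSet (ZMod r) R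
    · rw [← image_symSet_int, ← Finset.image_nsmul, Finset.mem_image] at hy
      obtain ⟨z, hz, hzy⟩ := hy
      exact ⟨z, fun _ => ⟨hz, by simpa using hzy⟩⟩
    · exact ⟨0, fun h => absurd h hy⟩
  choose f hf using hlift
  rw [← Finset.card_range (j + 1), ← Finset.card_product]
  refine Finset.card_le_card_of_injOn (fun p => f p.2 + (p.1 * r : ℕ)) ?_ ?_
  · rintro ⟨b, y⟩ hp
    simp only [Finset.coe_product, Set.mem_prod, Finset.mem_coe, Finset.mem_range] at hp
    simp only [Finset.mem_coe]
    rw [add_nsmul]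
    refine Finset.add_mem_add (hf y hp.2).1 ?_
    refine nsmul_subset_nsmul_of_le zero_mem_symSet (Nat.le_of_lt_succ hp.1) ?_
    have := Finset.nsmul_mem_nsmul (n := b) (natCast_mem_symSet (G := ℤ) hr)
    simpa using this
  · rintro ⟨b, y⟩ hp ⟨b', y'⟩ hp' h
    simp only [Finset.coe_product, Set.mem_prod, Finset.mem_coe, Finset.mem_range] at hp hp'
    simp only at h
    have hy : y = y' := by
      have := congrArg (fun z : ℤ => (z : ZMod r)) h
      simpa [(hf y hp.2).2, (hf y' hp'.2).2] using this
    subst hy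
    have : b * r = b' * r := by
      have := add_left_cancel h
      exact_mod_cast this
    rw [Nat.eq_of_mul_eq_mul_right hr0 this]

lemma card_le_card_symSet {Y : ℕ} (hpos : ∀ a ∈ R, 0 < a) (hle : ∀ a ∈ R, a ≤ Y) :
    R.card ≤ (symSet (ZMod Y) R).card := by
  refine Finset.card_le_card_of_injOn (fun a => (a : ZMod Y))
    (fun a ha => natCast_mem_symSet ha) ?_
  intro a ha b hb h
  simp only at h
  rw [ZMod.natCast_eq_natCast_iff] at h
  have h1 := hpos a ha
  have h2 := hle a ha
  have h3 := hpos b hb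
  have h4 := hle b hb
  have h5 := (Nat.modEq_iff_dvd.1 h)
  obtain ⟨c, hc⟩ := h5
  have h6 : c = 0 := by
    by_contra hne
    rcases lt_or_gt_of_ne hne with h | h
    · have : c ≤ -1 := by omega
      nlinarith
    · have : 1 ≤ c := by omega
      nlinarith
  rw [h6] at hc
  omega

/-- One factor `v` comes from linear growth modulo the largest element `r`, the other from lifting
with multiples of `r`. If the residues fill up early, `q² ≤ 8r` makes `r` classes enough. -/
lemma sq_mul_le_card_nsmul_symSet {r q v : ℕ} (hr : r ∈ R) (hmax : ∀ a ∈ R, a ≤ r)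
    (hpos : ∀ a ∈ R, 0 < a) (hgcd : R.gcd id = 1) (hq : q ≤ R.card) (hqr : q * q ≤ 8 * r)
    (hv : 0 < v) (hvq : v ≤ q) : v ^ 2 * q ≤ 4 * ((6 * v) • symSet ℤ R).card := by
  have hr0 := hpos r hr
  have : NeZero r := ⟨hr0.ne'⟩
  have hlift := mul_card_le_card_nsmul_symSet hr hr0 ((2 * 1 + 1) * (v - 1) + 1) (3 * v + 2)
  have hidx : (2 * 1 + 1) * (v - 1) + 1 + (3 * v + 2) = 6 * v := by omega
  rw [hidx] at hlift
  have hmin : v * q ≤ 8 * (((2 * 1 + 1) * (v - 1) + 1) • symSet (ZMod r) R).card := by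
    rcases nsmul_eq_univ_or_le_card (zero_mem_symSet (R := R)) neg_mem_symSet
      (closure_symSet_eq_top r hgcd) 1 (v - 1) with h | h
    · rw [h, Finset.card_univ, ZMod.card]
      exact (Nat.mul_le_mul_right q hvq).trans hqr
    · rw [one_nsmul, Nat.sub_add_cancel hv] at h
      have := card_le_card_symSet (R := R) hpos hmax
      have : v * q ≤ v * (symSet (ZMod r) R).card := Nat.mul_le_mul_left v (hq.trans this)
      omega
  generalize (((2 * 1 + 1) * (v - 1) + 1) • symSet (ZMod r) R).card = P at *
  nlinarith

lemma card_nsmul_symSet_zmod {r k Y : ℕ} (hr : ∀ a ∈ R, a ≤ r) (hY : 2 * (k * r) < Y) :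
    (k • symSet (ZMod Y) R).card = (k • symSet ℤ R).card := by
  rw [← image_symSet_int, ← Finset.image_nsmul]
  apply Finset.card_image_of_injOn
  intro x hx y hy h
  have h1 := abs_le.1 (abs_le_of_mem_nsmul_symSet hr k hx)
  have h2 := abs_le.1 (abs_le_of_mem_nsmul_symSet hr k hy)
  simp only [Int.coe_castAddHom] at h
  rw [ZMod.intCast_eq_intCast_iff_dvd_sub] at h
  have h3 : y - x = 0 := by
    apply Int.eq_zero_of_abs_lt_dvd h
    rw [abs_lt]
    have : (2 * (k * r) : ℤ) < Y := by exact_mod_cast hY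
    constructor <;> linarith
  omega

end SymmetricSet

/-! ### Growth modulo `Y` for rich sets -/

section Growth

/-- The conditions on a set `R` of positive integers under which its signed multiples grow fast. -/
structure Rich (l q : ℕ) (R : Finset ℕ) : Prop where
  subset : R ⊆ Finset.Icc 1 l
  card : q ≤ R.card
  gcd : R.gcd id = 1
  large : ∃ a ∈ R, l < 2 * a

variable {l q : ℕ} {R : Finset ℕ}

lemma Rich.sq_mul_le_card {Y v : ℕ} (hR : Rich l q R) (hql : q * q ≤ 4 * l)
    (hY : 12 * (q * l) < Y) (hv : 0 < v) (hvq : v ≤ q) :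
    v ^ 2 * q ≤ 4 * ((6 * v) • symSet (ZMod Y) R).card := by
  obtain ⟨a, ha, hal⟩ := hR.large
  obtain ⟨r, hr, hmax⟩ := Finset.exists_max_image R id ⟨a, ha⟩
  have hle : ∀ b ∈ R, b ≤ l := fun b hb => (Finset.mem_Icc.1 (hR.subset hb)).2
  rw [card_nsmul_symSet_zmod hle]
  · refine sq_mul_le_card_nsmul_symSet hr hmax
      (fun b hb => (Finset.mem_Icc.1 (hR.subset hb)).1) hR.gcd hR.card ?_ hv hvq
    have := hmax a ha
    simp only [id] at this
    omega
  · have := Nat.mul_le_mul_right l hvq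
    linarith [mul_assoc 6 v l]

/-- Two regimes: while `8N ≤ q³`, integer growth suffices, as `Y > 12ql` prevents wraparound; beyond
that, the `6q`-fold sumset is spread by linear growth modulo `Y`. -/
lemma Rich.exists_nsmul_card_ge {Y N : ℕ} (hR : Rich l q R) (hql : q * q ≤ 4 * l)
    (hlq : l ≤ q * q) (hY : 12 * (q * l) < Y) (hN : q ≤ N) (hNY : 2 * N ≤ Y) (hq : 0 < q) :
    ∃ t, (t * l) ^ 2 ≤ 152 ^ 2 * (N * Y) ∧ 2 * N ≤ (t • symSet (ZMod Y) R).card := by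
  by_cases hcase : 8 * N ≤ q ^ 2 * q
  · have hex : ∃ v, 0 < v ∧ 8 * N ≤ v ^ 2 * q := ⟨q, hq, hcase⟩
    classical
    obtain ⟨hv0, hv⟩ := Nat.find_spec hex
    have hvq : Nat.find hex ≤ q := Nat.find_min' hex ⟨hq, hcase⟩
    have hmin := fun m => @Nat.find_min _ _ hex m
    generalize Nat.find hex = v at *
    -- Minimality of `v` makes the choice tight up to a factor 4; for `v = 1` the bound is `q ≤ N`.
    have hv32 : v ^ 2 * q ≤ 32 * N := by
      rcases Nat.lt_or_ge v 2 with h | h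
      · have : v = 1 := by omega
        subst this
        omega
      · obtain ⟨w, rfl⟩ : ∃ w, v = w + 1 := ⟨v - 1, by omega⟩
        have h1 := hmin w (by omega)
        push Not at h1
        have h2 := h1 (by omega)
        have h3 : (w + 1) ^ 2 ≤ 4 * w ^ 2 := by nlinarith
        calc (w + 1) ^ 2 * q ≤ 4 * w ^ 2 * q := Nat.mul_le_mul_right q h3
          _ = 4 * (w ^ 2 * q) := by ring
          _ ≤ 32 * N := by omega
    refine ⟨6 * v, ?_, ?_⟩
    · have h1 : l * l ≤ q * Y := by
        calc l * l ≤ q * q * l := Nat.mul_le_mul_right l hlq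
          _ = q * (q * l) := by ring
          _ ≤ q * Y := Nat.mul_le_mul_left q (by omega)
      refine Nat.le_of_mul_le_mul_right ?_ hq
      calc (6 * v * l) ^ 2 * q = 36 * (v ^ 2 * q) * (l * l) := by ring
        _ ≤ 36 * (32 * N) * (q * Y) := by gcongr
        _ = 1152 * (N * Y) * q := by ring
        _ ≤ 152 ^ 2 * (N * Y) * q := by gcongr; norm_num
    · have := hR.sq_mul_le_card hql hY hv0 hvq
      omega
  · push Not at hcase
    have : NeZero Y := ⟨by omega⟩
    have hbase := hR.sq_mul_le_card hql hY hq le_rfl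
    have hq3 : 0 < q ^ 2 * q := by positivity
    set u := 8 * N / (q ^ 2 * q) with hu
    have hu1 : u * (q ^ 2 * q) ≤ 8 * N := Nat.div_mul_le_self _ _
    have hu2 : 8 * N < (u + 1) * (q ^ 2 * q) := by
      have := Nat.lt_div_mul_add hq3 (a := 8 * N)
      rw [add_mul, one_mul]; exact this
    refine ⟨(2 * (6 * q) + 1) * u + 6 * q, ?_, ?_⟩
    · have h1 : ((2 * (6 * q) + 1) * u + 6 * q) * l ≤ 152 * N := by
        refine Nat.le_of_mul_le_mul_right (c := q) ?_ hq
        calc ((2 * (6 * q) + 1) * u + 6 * q) * l * q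
            ≤ ((2 * (6 * q) + q) * u + 6 * q) * (q * q) * q := by
              gcongr; exact hq
          _ = q * (13 * (u * (q ^ 2 * q)) + 6 * (q ^ 2 * q)) := by ring
          _ ≤ q * (13 * (8 * N) + 6 * (8 * N)) := by gcongr
          _ = 152 * N * q := by ring
      calc (((2 * (6 * q) + 1) * u + 6 * q) * l) ^ 2 ≤ (152 * N) ^ 2 := by gcongr
        _ = 152 ^ 2 * (N * N) := by ring
        _ ≤ 152 ^ 2 * (N * Y) := by gcongr; omega
    · rcases nsmul_eq_univ_or_le_card (zero_mem_symSet (R := R)) neg_mem_symSet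
        (closure_symSet_eq_top Y hR.gcd) (6 * q) u with h | h
      · rw [h, Finset.card_univ, ZMod.card]
        exact hNY
      · have := Nat.mul_le_mul_left (u + 1) hbase
        have h4 : (u + 1) * (4 * ((6 * q) • symSet (ZMod Y) R).card) =
          4 * ((u + 1) * ((6 * q) • symSet (ZMod Y) R).card) := by ring
        omega

lemma Rich.exists_shiftExcess {Y : ℕ} (hR : Rich l q R) (hql : q * q ≤ 4 * l)
    (hlq : l ≤ q * q) (hY : 12 * (q * l) < Y) (hq : 0 < q) {B : Finset (ZMod Y)}
    (hB : q ≤ B.card) (hBY : 2 * B.card ≤ Y) :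
    ∃ a ∈ R, B.card * l ^ 2 ≤ 304 ^ 2 * Y * shiftExcess B (a : ZMod Y) ^ 2 := by
  obtain ⟨t, ht, htB⟩ := hR.exists_nsmul_card_ge hql hlq hY hB hBY hq
  have hBpos : 0 < B.card := by omega
  obtain ⟨x, hx, hxB⟩ := exists_shiftExcess_ge (Finset.card_pos.1 hBpos)
    ⟨0, zero_mem_symSet⟩ htB
  have key : B.card * l ^ 2 ≤ 304 ^ 2 * Y * shiftExcess B x ^ 2 := by
    refine Nat.le_of_mul_le_mul_left ?_ hBpos
    calc B.card * (B.card * l ^ 2) = (B.card * l) ^ 2 := by ring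
      _ ≤ (2 * (t * shiftExcess B x) * l) ^ 2 := by gcongr
      _ = 4 * shiftExcess B x ^ 2 * (t * l) ^ 2 := by ring
      _ ≤ 4 * shiftExcess B x ^ 2 * (152 ^ 2 * (B.card * Y)) := by gcongr
      _ = _ := by ring
  rw [mem_symSet] at hx
  rcases hx with rfl | ⟨a, ha, rfl | rfl⟩
  · rw [shiftExcess_zero] at hxB
    omega
  · exact ⟨a, ha, key⟩
  · rw [shiftExcess_neg] at key
    exact ⟨a, ha, key⟩

end Growth

/-! ### From residues modulo `Y` to an interval of subset sums -/

section Filling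

/-- The subset sums of `D` modulo `Y`. -/
def sumsMod (Y : ℕ) (D : Finset ℕ) : Finset (ZMod Y) :=
  D.powerset.image (fun S => ((∑ s ∈ S, s : ℕ) : ZMod Y))

lemma mem_sumsMod {Y : ℕ} {D : Finset ℕ} {z : ZMod Y} :
    z ∈ sumsMod Y D ↔ ∃ S ⊆ D, ((∑ s ∈ S, s : ℕ) : ZMod Y) = z := by
  simp [sumsMod]

lemma sumsMod_insert {Y a : ℕ} {D : Finset ℕ} (ha : a ∉ D) :
    sumsMod Y (insert a D) = sumsMod Y D ∪ ((a : ZMod Y) +ᵥ sumsMod Y D) := by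
  ext z
  simp only [Finset.mem_union, Finset.mem_vadd_finset, mem_sumsMod]
  constructor
  · rintro ⟨S, hS, rfl⟩
    by_cases haS : a ∈ S
    · right
      refine ⟨_, ⟨S.erase a, ?_, rfl⟩, ?_⟩
      · intro x hx
        rw [Finset.mem_erase] at hx
        exact (Finset.mem_insert.1 (hS hx.2)).resolve_left hx.1
      · rw [vadd_eq_add, ← Nat.cast_add, Finset.add_sum_erase S (fun x => x) haS]
    · left
      exact ⟨S, (Finset.subset_insert_iff_of_notMem haS).1 hS, rfl⟩
  · rintro (⟨S, hS, rfl⟩ | ⟨y, ⟨S, hS, rfl⟩, rfl⟩)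
    · exact ⟨S, hS.trans (Finset.subset_insert a D), rfl⟩
    · refine ⟨insert a S, Finset.insert_subset_insert a hS, ?_⟩
      rw [Finset.sum_insert (fun h => ha (hS h)), Nat.cast_add, vadd_eq_add]

lemma card_le_card_sumsMod {Y : ℕ} {D : Finset ℕ} (hD : ∀ a ∈ D, a < Y) :
    D.card ≤ (sumsMod Y D).card := by
  refine Finset.card_le_card_of_injOn (fun a => (a : ZMod Y)) ?_ ?_
  · intro a ha
    exact mem_sumsMod.2 ⟨{a}, by simpa using ha, by simp⟩
  · intro a ha b hb h
    simp only at h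
    rw [ZMod.natCast_eq_natCast_iff] at h
    exact Nat.ModEq.eq_of_lt_of_lt h (hD a ha) (hD b hb)

/-- `A` remains rich after the removal of any `m` elements. -/
def Robust (l q m : ℕ) (A : Finset ℕ) : Prop :=
  ∀ D ⊆ A, D.card ≤ m → Rich l q (A \ D)

variable {l q m : ℕ} {A : Finset ℕ}

lemma Robust.rich (hA : Robust l q m A) : Rich l q A := by
  simpa using hA ∅ (Finset.empty_subset A) (by simp)

lemma Robust.sdiff (hA : Robust l q m A) {D : Finset ℕ} (hD : D ⊆ A) (hDm : D.card ≤ m) :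
    Robust l q (m - D.card) (A \ D) := by
  intro E hE hEm
  rw [sdiff_sdiff_left]
  refine hA _ (Finset.union_subset hD (hE.trans Finset.sdiff_subset)) ?_
  exact (Finset.card_union_le D E).trans (by omega)

/-- Discrete form of `dN/ds ≳ l √(N / Y)`, whose solution is quadratic in `s`. The constant is `912
= 3 · 304`, because `(s + 2)² ≤ (s + 1)² + 3(s + 1)`. -/
lemma add_two_sq_mul_le {Y N s g : ℕ} (h1 : (s + 1) ^ 2 * l ^ 2 ≤ 912 ^ 2 * (Y * N))
    (h2 : N * l ^ 2 ≤ 304 ^ 2 * Y * g ^ 2) :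
    (s + 2) ^ 2 * l ^ 2 ≤ 912 ^ 2 * (Y * (N + g)) := by
  have key : 3 * (s + 1) * l ^ 2 ≤ 912 ^ 2 * (Y * g) := by
    refine (Nat.pow_le_pow_iff_left (n := 2) (by norm_num)).1 ?_
    calc (3 * (s + 1) * l ^ 2) ^ 2 = 9 * l ^ 2 * ((s + 1) ^ 2 * l ^ 2) := by ring
      _ ≤ 9 * l ^ 2 * (912 ^ 2 * (Y * N)) := by gcongr
      _ = 9 * 912 ^ 2 * Y * (N * l ^ 2) := by ring
      _ ≤ 9 * 912 ^ 2 * Y * (304 ^ 2 * Y * g ^ 2) := by gcongr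
      _ = (912 ^ 2 * (Y * g)) ^ 2 := by ring
  calc (s + 2) ^ 2 * l ^ 2 ≤ ((s + 1) ^ 2 + 3 * (s + 1)) * l ^ 2 := by
        gcongr; nlinarith
    _ = (s + 1) ^ 2 * l ^ 2 + 3 * (s + 1) * l ^ 2 := by ring
    _ ≤ 912 ^ 2 * (Y * N) + 912 ^ 2 * (Y * g) := Nat.add_le_add h1 key
    _ = _ := by ring

/-- Greedy choice: start with `q` elements, then add the element of largest guaranteed gain. After
`912Y / l` steps the quadratic lower bound would exceed `Y`; the initial `q` elements account for
the extra `Y` in `913Y`. -/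
lemma Robust.exists_lt_two_mul_card {Y : ℕ} (hA : Robust l q m A) (hql : q * q ≤ 4 * l)
    (hlq : l ≤ q * q) (hY : 12 * (q * l) < Y) (hq : 0 < q) (hm : 913 * Y ≤ m * l) :
    ∃ D ⊆ A, D.card * l ≤ 913 * Y ∧ Y < 2 * (sumsMod Y D).card := by
  have hl : 0 < l := by
    by_contra h
    have : l = 0 := by omega
    subst this
    nlinarith
  have hlql : l ≤ q * l := Nat.le_mul_of_pos_left l hq
  have hrem : ∀ d : ℕ, d * l ≤ 913 * Y → d ≤ m := fun d hd =>
    Nat.le_of_mul_le_mul_right (hd.trans hm) hl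
  have main : ∀ s : ℕ, s * l ≤ 912 * Y → ∃ D ⊆ A, D.card ≤ q + s ∧
      (Y < 2 * (sumsMod Y D).card ∨ (q ≤ (sumsMod Y D).card ∧
        (s + 1) ^ 2 * l ^ 2 ≤ 912 ^ 2 * (Y * (sumsMod Y D).card))) := by
    intro s
    induction s with
    | zero =>
      intro _
      obtain ⟨D, hD, hDq⟩ := Finset.exists_subset_card_eq hA.rich.card
      have hDl : ∀ a ∈ D, a < Y := fun a ha => by
        have := (Finset.mem_Icc.1 (hA.rich.subset (hD ha))).2
        omega
      have hcard := card_le_card_sumsMod hDl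
      rw [hDq] at hcard
      refine ⟨D, hD, hDq.le, Or.inr ⟨hcard, ?_⟩⟩
      calc (0 + 1) ^ 2 * l ^ 2 = l * l := by ring
        _ ≤ l * (q * q) := by gcongr
        _ = q * l * q := by ring
        _ ≤ Y * (sumsMod Y D).card := by gcongr; omega
        _ ≤ _ := Nat.le_mul_of_pos_left _ (by norm_num)
    | succ s ih =>
      intro hs
      have hs' : s * l ≤ 912 * Y := by linarith [add_one_mul s l]
      obtain ⟨D, hD, hDq, hDs⟩ := ih hs'
      by_cases hbig : Y < 2 * (sumsMod Y D).card
      · exact ⟨D, hD, by omega, Or.inl hbig⟩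
      obtain ⟨hqB, hsB⟩ := hDs.resolve_left hbig
      have hDm : D.card ≤ m := by
        refine hrem _ ?_
        have := Nat.mul_le_mul_right l hDq
        linarith [add_mul q s l]
      obtain ⟨a, ha, hal⟩ := (hA D hD hDm).exists_shiftExcess hql hlq hY hq hqB
        (by omega)
      rw [Finset.mem_sdiff] at ha
      refine ⟨insert a D, Finset.insert_subset ha.1 hD, ?_, Or.inr ?_⟩
      · rw [Finset.card_insert_of_notMem ha.2]; omega
      · rw [sumsMod_insert ha.2, card_union_vadd]
        exact ⟨by omega, add_two_sq_mul_le hsB hal⟩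
  obtain ⟨D, hD, hDq, hDs⟩ := main (912 * Y / l) (Nat.div_mul_le_self _ _)
  refine ⟨D, hD, ?_, ?_⟩
  · have h1 := Nat.mul_le_mul_right l hDq
    have h2 := Nat.div_mul_le_self (912 * Y) l
    linarith [add_mul q (912 * Y / l) l]
  · rcases hDs with h | ⟨-, h⟩
    · exact h
    · by_contra hcon
      have h1 : 912 * Y < (912 * Y / l + 1) * l := by
        rw [add_mul, one_mul]
        exact Nat.lt_div_mul_add hl
      have h2 : (912 * Y) ^ 2 < (912 * Y / l + 1) ^ 2 * l ^ 2 := by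
        rw [← mul_pow]
        exact Nat.pow_lt_pow_left h1 (by norm_num)
      have h3 : Y * (sumsMod Y D).card ≤ Y * Y := Nat.mul_le_mul_left Y (by omega)
      nlinarith

/-- The subset sums of `D` meet every residue class modulo `Y`. -/
def FillsMod (Y : ℕ) (D : Finset ℕ) : Prop :=
  ∀ z : ZMod Y, ∃ S ⊆ D, ((∑ s ∈ S, s : ℕ) : ZMod Y) = z

/-- Pigeonhole: the sums of `D` and `z` minus the sums of `E` each occupy more than half the group,
so they meet. -/
lemma fillsMod_union {Y : ℕ} (hY : 0 < Y) {D E : Finset ℕ} (hDE : Disjoint D E)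
    (hD : Y < 2 * (sumsMod Y D).card) (hE : Y < 2 * (sumsMod Y E).card) :
    FillsMod Y (D ∪ E) := by
  have : NeZero Y := ⟨hY.ne'⟩
  intro z
  have hcard : ((sumsMod Y E).image (fun x => z - x)).card = (sumsMod Y E).card :=
    Finset.card_image_of_injective _ sub_right_injective
  have hinter : (sumsMod Y D ∩ (sumsMod Y E).image (fun x => z - x)).Nonempty := by
    rw [← Finset.card_pos]
    have h1 := Finset.card_union_add_card_inter (sumsMod Y D)
      ((sumsMod Y E).image (fun x => z - x))
    have h2 := Finset.card_le_univ (sumsMod Y D ∪ (sumsMod Y E).image (fun x => z - x))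
    rw [ZMod.card] at h2
    omega
  obtain ⟨x, hx⟩ := hinter
  rw [Finset.mem_inter, Finset.mem_image] at hx
  obtain ⟨hxD, y, hyE, hxy⟩ := hx
  obtain ⟨S, hS, hSx⟩ := mem_sumsMod.1 hxD
  obtain ⟨T, hT, hTy⟩ := mem_sumsMod.1 hyE
  refine ⟨S ∪ T, Finset.union_subset_union hS hT, ?_⟩
  rw [Finset.sum_union (Finset.disjoint_of_subset_left hS
    (Finset.disjoint_of_subset_right hT hDE)), Nat.cast_add, hSx, hTy, ← hxy]
  ring

lemma Robust.exists_fillsMod {Y : ℕ} (hA : Robust l q m A) (hql : q * q ≤ 4 * l)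
    (hlq : l ≤ q * q) (hY : 12 * (q * l) < Y) (hq : 0 < q) (hl : 0 < l)
    (hm : 1826 * Y ≤ m * l) :
    ∃ D ⊆ A, D.card * l ≤ 1826 * Y ∧ FillsMod Y D := by
  obtain ⟨D, hD, hDl, hDY⟩ := hA.exists_lt_two_mul_card hql hlq hY hq (by omega)
  have hDm : D.card ≤ m := Nat.le_of_mul_le_mul_right (c := l) (by omega) hl
  obtain ⟨E, hE, hEl, hEY⟩ := (hA.sdiff hD hDm).exists_lt_two_mul_card hql hlq hY hq
    (by rw [Nat.sub_mul]; omega)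
  have hdisj : Disjoint D E := Finset.disjoint_of_subset_right hE Finset.disjoint_sdiff
  refine ⟨D ∪ E, Finset.union_subset hD (hE.trans Finset.sdiff_subset), ?_,
    fillsMod_union (by omega) hdisj hDY hEY⟩
  rw [Finset.card_union_of_disjoint hdisj, add_mul]
  omega

lemma Robust.exists_family_fillsMod {Y : ℕ} (hA : Robust l q m A) (hql : q * q ≤ 4 * l)
    (hlq : l ≤ q * q) (hY : 12 * (q * l) < Y) (hq : 0 < q) (hl : 0 < l) (g : ℕ)
    (hm : g * (1826 * Y) ≤ m * l) :
    ∃ F : ℕ → Finset ℕ, (∀ i < g, F i ⊆ A ∧ (F i).card * l ≤ 1826 * Y ∧ FillsMod Y (F i)) ∧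
      ∀ i < g, ∀ j < i, Disjoint (F i) (F j) := by
  induction g with
  | zero => exact ⟨fun _ => ∅, by simp, by simp⟩
  | succ g ih =>
    rw [add_mul, one_mul] at hm
    obtain ⟨F, hF, hdisj⟩ := ih (by omega)
    set D := (Finset.range g).biUnion F with hD
    have hDA : D ⊆ A := Finset.biUnion_subset.2 fun i hi => (hF i (Finset.mem_range.1 hi)).1
    have hDl : D.card * l ≤ g * (1826 * Y) := by
      calc D.card * l ≤ (∑ i ∈ Finset.range g, (F i).card) * l :=
            Nat.mul_le_mul_right l Finset.card_biUnion_le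
        _ = ∑ i ∈ Finset.range g, (F i).card * l := by rw [Finset.sum_mul]
        _ ≤ ∑ i ∈ Finset.range g, 1826 * Y :=
            Finset.sum_le_sum fun i hi => (hF i (Finset.mem_range.1 hi)).2.1
        _ = _ := by simp
    have hDm : D.card ≤ m := Nat.le_of_mul_le_mul_right (c := l) (by omega) hl
    obtain ⟨E, hE, hEl, hEY⟩ := (hA.sdiff hDA hDm).exists_fillsMod hql hlq hY hq hl
      (by rw [Nat.sub_mul]; omega)
    refine ⟨fun i => if i = g then E else F i, ?_, ?_⟩
    · intro i hi
      by_cases hig : i = g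
      · simp only [hig, if_true]
        exact ⟨hE.trans Finset.sdiff_subset, hEl, hEY⟩
      · simp only [hig, if_false]
        exact hF i (by omega)
    · intro i hi j hji
      have hjg : j ≠ g := by omega
      by_cases hig : i = g
      · simp only [hig, hjg, if_true, if_false]
        refine Finset.disjoint_of_subset_left hE ?_
        refine Finset.disjoint_of_subset_right ?_ Finset.sdiff_disjoint
        exact Finset.subset_biUnion_of_mem F (Finset.mem_range.2 (by omega))
      · simp only [hig, hjg, if_false]
        exact hdisj i (by omega) j hji

lemma sum_le_card_mul {S D : Finset ℕ} (hA : A ⊆ Finset.Icc 1 l) (hD : D ⊆ A) (hS : S ⊆ D) :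
    ∑ s ∈ S, s ≤ D.card * l := by
  calc ∑ s ∈ S, s ≤ ∑ s ∈ S, l :=
        Finset.sum_le_sum fun s hs => (Finset.mem_Icc.1 (hA (hD (hS hs)))).2
    _ = S.card * l := by simp
    _ ≤ D.card * l := Nat.mul_le_mul_right l (Finset.card_le_card hS)

/-- Disjoint blocks each yield a sum of the form `w Y₀ - 1` with `1 ≤ w ≤ 1826`; `1827` of them
share the same `w`, and adding up `j` of these gives `j` times a common step. -/
lemma Robust.exists_long_progression {Y₀ : ℕ} (hA : Robust l q m A) (hql : q * q ≤ 4 * l)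
    (hlq : l ≤ q * q) (hY : 12 * (q * l) + 1 < Y₀) (hq : 0 < q) (hl : 0 < l)
    (hm : (1826 * 1827) * (1826 * Y₀) ≤ m * l) :
    ∃ D ⊆ A, ∃ Y, D.card * l ≤ (1826 * 1827) * (1826 * Y₀) ∧ Y₀ ≤ Y + 1 ∧ Y ≤ 1826 * Y₀ ∧
      ∀ j ≤ 1827, ∃ S ⊆ D, ∑ s ∈ S, s = j * Y := by
  obtain ⟨F, hF, hdisj⟩ := hA.exists_family_fillsMod hql hlq (by omega) hq hl (1826 * 1827) hm
  -- The target residue is `-1`, not `0`, which the empty sum attains, and not `1`, which a tiny sum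
  -- could attain: it forces each sum to be at least `Y₀ - 1`.
  generalize hg : 1826 * 1827 = g at *
  have hsub : ∀ i, ∃ S, i < g → S ⊆ F i ∧ ((∑ s ∈ S, s : ℕ) : ZMod Y₀) = -1 := by
    intro i
    by_cases hi : i < g
    · obtain ⟨S, hS, hS'⟩ := (hF i hi).2.2 (-1)
      exact ⟨S, fun _ => ⟨hS, hS'⟩⟩
    · exact ⟨∅, fun h => absurd h hi⟩
  choose U hU using hsub
  have hUY : ∀ i, ∃ w, i < g → w ∈ Finset.Icc 1 1826 ∧ ∑ s ∈ U i, s + 1 = w * Y₀ := by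
    intro i
    by_cases hi : i < g
    swap
    · exact ⟨0, fun h => absurd h hi⟩
    have hdvd : Y₀ ∣ ∑ s ∈ U i, s + 1 := by
      rw [← ZMod.natCast_eq_zero_iff, Nat.cast_add, (hU i hi).2]
      simp
    obtain ⟨w, hw⟩ := hdvd
    have hle := (sum_le_card_mul hA.rich.subset (hF i hi).1 (hU i hi).1).trans (hF i hi).2.1
    refine ⟨w, fun _ => ⟨?_, by rw [hw, mul_comm]⟩⟩
    rw [Finset.mem_Icc]
    constructor
    · by_contra h
      have : w = 0 := by omega
      subst this
      omega
    · by_contra h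
      have : Y₀ * 1827 ≤ Y₀ * w := Nat.mul_le_mul_left _ (by omega)
      omega
  choose w hw using hUY
  obtain ⟨v, hv, hcard⟩ := Finset.exists_le_card_fiber_of_mul_le_card_of_maps_to
    (s := Finset.range g) (t := Finset.Icc 1 1826) (f := w) (n := 1827)
    (fun i hi => (hw i (Finset.mem_range.1 hi)).1) ⟨1, by simp⟩ (by simp [← hg])
  rw [Finset.mem_Icc] at hv
  have hvY : Y₀ ≤ v * Y₀ := Nat.le_mul_of_pos_left _ hv.1
  have hvY' : v * Y₀ ≤ 1826 * Y₀ := Nat.mul_le_mul_right _ hv.2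
  refine ⟨(Finset.range g).biUnion F,
    Finset.biUnion_subset.2 fun i hi => (hF i (Finset.mem_range.1 hi)).1, v * Y₀ - 1, ?_,
    by omega, by omega, ?_⟩
  · calc ((Finset.range g).biUnion F).card * l ≤ (∑ i ∈ Finset.range g, (F i).card) * l :=
          Nat.mul_le_mul_right l Finset.card_biUnion_le
      _ = ∑ i ∈ Finset.range g, (F i).card * l := by rw [Finset.sum_mul]
      _ ≤ ∑ i ∈ Finset.range g, 1826 * Y₀ :=
          Finset.sum_le_sum fun i hi => (hF i (Finset.mem_range.1 hi)).2.1
      _ = _ := by simp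
  · intro j hj
    obtain ⟨J, hJ, hJcard⟩ := Finset.exists_subset_card_eq (hj.trans hcard)
    have hJg : ∀ i ∈ J, i < g ∧ w i = v := fun i hi => by
      have := hJ hi
      rwa [Finset.mem_filter, Finset.mem_range] at this
    refine ⟨J.biUnion U, ?_, ?_⟩
    · refine Finset.biUnion_subset.2 fun i hi => (hU i (hJg i hi).1).1.trans ?_
      exact Finset.subset_biUnion_of_mem F (Finset.mem_range.2 (hJg i hi).1)
    · have hpd : Set.PairwiseDisjoint (↑J) U := by
        intro i hi j hj hij
        have h1 := hJg i hi
        have h2 := hJg j hj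
        refine Finset.disjoint_of_subset_left (hU i h1.1).1
          (Finset.disjoint_of_subset_right (hU j h2.1).1 ?_)
        rcases lt_or_gt_of_ne hij with h | h
        · exact (hdisj j h2.1 i h).symm
        · exact hdisj i h1.1 j h
      rw [Finset.sum_biUnion hpd, ← hJcard, ← smul_eq_mul, ← Finset.sum_const]
      refine Finset.sum_congr rfl fun i hi => ?_
      have h1 := (hw i (hJg i hi).1).2
      rw [(hJg i hi).2] at h1
      omega

/-- A further block `E` hits every residue modulo the step `Y` with sums at most `1826Y`; from
`1826Y` on, multiples of `Y` from the disjoint progression make up the difference. -/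
lemma Robust.exists_interval {Y₀ : ℕ} (hA : Robust l q m A) (hql : q * q ≤ 4 * l)
    (hlq : l ≤ q * q) (hY : 12 * (q * l) + 1 < Y₀) (hq : 0 < q) (hl : 0 < l)
    (hm : (1826 * 1827 + 1826) * (1826 * Y₀) ≤ m * l) :
    ∃ a, ∀ i, i + 1 < Y₀ → a + i ∈ subsetSums A := by
  rw [add_mul] at hm
  obtain ⟨D, hD, Y, hDl, hY1, hY2, hDY⟩ := hA.exists_long_progression hql hlq hY hq hl (by omega)
  have hDm : D.card ≤ m := Nat.le_of_mul_le_mul_right (c := l) (by omega) hl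
  obtain ⟨E, hE, hEl, hEY⟩ := (hA.sdiff hD hDm).exists_fillsMod (Y := Y) hql hlq (by omega) hq hl
    (by rw [Nat.sub_mul]; omega)
  have hdisj : Disjoint D E := Finset.disjoint_of_subset_right hE Finset.disjoint_sdiff
  refine ⟨1826 * Y, fun i hi => ?_⟩
  obtain ⟨T, hT, hTz⟩ := hEY ((1826 * Y + i : ℕ) : ZMod Y)
  have hTl := (sum_le_card_mul (hA.sdiff hD hDm).rich.subset hE hT).trans hEl
  rw [ZMod.natCast_eq_natCast_iff] at hTz
  obtain ⟨j, hj⟩ := (Nat.modEq_iff_dvd' (by omega)).1 hTz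
  have hj' : j ≤ 1827 := by
    by_contra h
    have : Y * 1828 ≤ Y * j := Nat.mul_le_mul_left _ (by omega)
    omega
  obtain ⟨S, hS, hSj⟩ := hDY j hj'
  refine ⟨S ∪ T, Finset.union_subset (hS.trans hD) ((hT.trans hE).trans Finset.sdiff_subset), ?_⟩
  rw [Finset.sum_union (Finset.disjoint_of_subset_left hS
    (Finset.disjoint_of_subset_right hT hdisj)), hSj, mul_comm j Y, ← hj]
  omega

end Filling

/-! ### Passing to half the scale -/

section Reduction

/-- The subset sums of `A` contain a homogeneous progression of length `n`. -/
def HasHomogeneous (n : ℕ) (A : Finset ℕ) : Prop :=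
  ∃ a d : ℕ, 0 < d ∧ d ∣ a ∧ ∀ i < n, a + i * d ∈ subsetSums A

lemma HasHomogeneous.mono {n : ℕ} {A B : Finset ℕ} (h : HasHomogeneous n A) (hAB : A ⊆ B) :
    HasHomogeneous n B := by
  obtain ⟨a, d, hd, hda, h⟩ := h
  refine ⟨a, d, hd, hda, fun i hi => ?_⟩
  obtain ⟨S, hS, hSi⟩ := h i hi
  exact ⟨S, hS.trans hAB, hSi⟩

lemma HasHomogeneous.image_mul {n g : ℕ} (hg : 0 < g) {A : Finset ℕ} (h : HasHomogeneous n A) :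
    HasHomogeneous n (A.image (fun a => g * a)) := by
  obtain ⟨a, d, hd, hda, h⟩ := h
  refine ⟨g * a, g * d, Nat.mul_pos hg hd, Nat.mul_dvd_mul_left g hda, fun i hi => ?_⟩
  obtain ⟨S, hS, hSi⟩ := h i hi
  refine ⟨S.image (fun a => g * a), Finset.image_subset_image hS, ?_⟩
  rw [Finset.sum_image (fun x _ y _ hxy => Nat.eq_of_mul_eq_mul_left hg hxy), ← Finset.mul_sum, hSi]
  ring

lemma exists_half_scale_of_not_rich {n l q : ℕ} {R : Finset ℕ} (hR : R ⊆ Finset.Icc 1 l)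
    (hq : 0 < q) (hqR : q ≤ R.card) (h : ¬ Rich l q R) :
    ∃ R' ⊆ Finset.Icc 1 (l / 2), R'.card = R.card ∧
      (HasHomogeneous n R' → HasHomogeneous n R) := by
  by_cases hgcd : R.gcd id = 1
  · refine ⟨R, fun a ha => ?_, rfl, id⟩
    have h1 := Finset.mem_Icc.1 (hR ha)
    rw [Finset.mem_Icc]
    refine ⟨h1.1, ?_⟩
    by_contra h2
    exact h ⟨hR, hqR, hgcd, a, ha, by omega⟩
  · set g := R.gcd id with hg
    have hdvd : ∀ a ∈ R, g ∣ a := fun a ha => Finset.gcd_dvd (f := id) ha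
    obtain ⟨b, hb⟩ : R.Nonempty := Finset.card_pos.1 (by omega)
    have hg0 : 0 < g := Nat.pos_of_dvd_of_pos (hdvd b hb) (Finset.mem_Icc.1 (hR hb)).1
    have himage : (R.image (fun a => a / g)).image (fun a => g * a) = R := by
      rw [Finset.image_image]
      conv_rhs => rw [← Finset.image_id (s := R)]
      exact Finset.image_congr fun a ha => Nat.mul_div_cancel' (hdvd a ha)
    refine ⟨R.image (fun a => a / g), ?_, ?_, ?_⟩
    · intro x hx
      rw [Finset.mem_image] at hx
      obtain ⟨a, ha, rfl⟩ := hx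
      have h1 := Finset.mem_Icc.1 (hR ha)
      rw [Finset.mem_Icc]
      refine ⟨Nat.div_pos (Nat.le_of_dvd h1.1 (hdvd a ha)) hg0, ?_⟩
      calc a / g ≤ a / 2 := Nat.div_le_div_left (by omega) (by norm_num)
        _ ≤ l / 2 := Nat.div_le_div_right h1.2
    · apply Finset.card_image_of_injOn
      intro x hx y hy hxy
      simp only at hxy
      rw [← Nat.mul_div_cancel' (hdvd x hx), hxy, Nat.mul_div_cancel' (hdvd y hy)]
    · intro h
      have := h.image_mul hg0
      rwa [himage] at this

/-- The cost, relative to the scale, of one application of `Robust.exists_interval`. -/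
def cost : ℕ := (1826 * 1827 + 1826) * 1826

lemma hasHomogeneous_or_half_scale {n l : ℕ} (hn : 0 < n) (hl : 0 < l) {A : Finset ℕ}
    (hA : A ⊆ Finset.Icc 1 l)
    (hcard : 25 * cost * (Real.sqrt l + n / l) + 2 * Real.sqrt l ≤ A.card) :
    HasHomogeneous n A ∨ ∃ A' ⊆ Finset.Icc 1 (l / 2),
      A.card ≤ A'.card + 25 * cost * (Real.sqrt l + n / l) ∧
      (HasHomogeneous n A' → HasHomogeneous n A) := by
  -- Here `l ≤ q² ≤ 4l`, and `Y₀` both rules out wraparound and leaves room for `n` consecutive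
  -- sums. The `2√l` in the hypothesis keeps `q` elements after deletion, so richness can fail only
  -- through the gcd or the missing large element.
  set q := Nat.sqrt l + 1 with hq
  set Y₀ := 12 * (q * l) + n + 2 with hY₀
  set m := cost * Y₀ / l + 1 with hm
  have hs1 : 1 ≤ Nat.sqrt l := Nat.sqrt_pos.2 hl
  have hs2 : Nat.sqrt l * Nat.sqrt l ≤ l := Nat.sqrt_le l
  have hql : q * q ≤ 4 * l := by
    calc q * q ≤ (2 * Nat.sqrt l) * (2 * Nat.sqrt l) := by gcongr <;> omega
      _ = 4 * (Nat.sqrt l * Nat.sqrt l) := by ring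
      _ ≤ 4 * l := by gcongr
  have hlq : l ≤ q * q := (Nat.lt_succ_sqrt l).le
  have hml : cost * Y₀ ≤ m * l := by
    rw [hm, add_mul, one_mul]
    exact (Nat.lt_div_mul_add hl).le
  have hlR : (1 : ℝ) ≤ l := by exact_mod_cast hl
  have hnR : (1 : ℝ) ≤ n := by exact_mod_cast hn
  have hsq1 : 1 ≤ Real.sqrt l := Real.one_le_sqrt.2 hlR
  have hqR : (q : ℝ) ≤ 2 * Real.sqrt l := by
    have : (Nat.sqrt l : ℝ) ≤ Real.sqrt l := Real.nat_sqrt_le_real_sqrt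
    rw [hq]; push_cast; linarith
  have hc : (1 : ℝ) ≤ cost := by norm_num [cost]
  have hmR : (m : ℝ) ≤ 25 * cost * (Real.sqrt l + n / l) := by
    have h1 : ((cost * Y₀ / l : ℕ) : ℝ) ≤ (cost * Y₀ : ℕ) / l := Nat.cast_div_le
    have h2 : ((cost * Y₀ : ℕ) : ℝ) / l = cost * (12 * q + (n + 2) / l) := by
      rw [hY₀]; push_cast; field_simp; ring
    have h3 : ((n : ℝ) + 2) / l ≤ 3 * (n / l) := by
      rw [← mul_div_assoc]; gcongr; linarith
    have h4 : (cost : ℝ) * (12 * q + (n + 2) / l) ≤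
        cost * (12 * (2 * Real.sqrt l) + 3 * (n / l)) := by gcongr
    have h5 : 0 ≤ (cost : ℝ) * (n / l) := by positivity
    have h6 : (1 : ℝ) ≤ cost * Real.sqrt l := by nlinarith
    rw [hm, Nat.cast_add, Nat.cast_one]
    linarith
  by_cases hrob : Robust l q m A
  · left
    obtain ⟨a, ha⟩ := hrob.exists_interval (Y₀ := Y₀) hql hlq (by omega) (by omega) hl
      (by rw [← mul_assoc]; exact hml)
    exact ⟨a, 1, one_pos, one_dvd a, fun i hi => by rw [mul_one]; exact ha i (by omega)⟩
  · right
    unfold Robust at hrob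
    push Not at hrob
    obtain ⟨D, hD, hDm, hrich⟩ := hrob
    have hsd : ((A \ D).card : ℝ) + D.card = A.card := by
      exact_mod_cast Finset.card_sdiff_add_card_eq_card hD
    have hDR : (D.card : ℝ) ≤ m := by exact_mod_cast hDm
    have hqAD : q ≤ (A \ D).card := by
      have : (q : ℝ) ≤ (A \ D).card := by linarith
      exact_mod_cast this
    obtain ⟨A', hA', hcard', himp⟩ := exists_half_scale_of_not_rich (n := n)
      (Finset.sdiff_subset.trans hA) (by omega) hqAD hrich
    refine ⟨A', hA', ?_, fun h => (himp h).mono Finset.sdiff_subset⟩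
    rw [hcard']
    linarith

/-- The threshold is a potential: when `l` is halved, `√l` falls by at least a quarter and `n / l`
at least doubles, so it drops by at least the deletion cost `25 * cost * (√l + n / l)`. The term in
`√n` keeps it positive, since `n / l ≤ √n`. -/
lemma hasHomogeneous_of_card {n : ℕ} (hn : 0 < n) (l : ℕ) :
    ∀ A ⊆ Finset.Icc 1 l, Real.sqrt n ≤ A.card →
      100 * cost * Real.sqrt l - 25 * cost * (n / l) + 75 * cost * Real.sqrt n ≤ A.card →
      HasHomogeneous n A := by
  induction l using Nat.strong_induction_on with
  | _ l ih =>
  intro A hA hnA hlA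
  have hnR : (1 : ℝ) ≤ n := by exact_mod_cast hn
  have hc : (1 : ℝ) ≤ cost := by norm_num [cost]
  generalize hcc : (cost : ℝ) = c at *
  have hsn : 1 ≤ Real.sqrt n := Real.one_le_sqrt.2 hnR
  have hAl : A.card ≤ l := by simpa using Finset.card_le_card hA
  have hAlR : (A.card : ℝ) ≤ l := by exact_mod_cast hAl
  have hlR : (1 : ℝ) ≤ l := by linarith
  have hl : 0 < l := by exact_mod_cast (by linarith : (0 : ℝ) < l)
  have hsl : 1 ≤ Real.sqrt l := Real.one_le_sqrt.2 hlR
  have hnl : (n : ℝ) / l ≤ Real.sqrt n := by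
    rw [div_le_iff₀ (by linarith)]
    calc (n : ℝ) = Real.sqrt n * Real.sqrt n := (Real.mul_self_sqrt (by linarith)).symm
      _ ≤ Real.sqrt n * l := by gcongr; linarith
  have h1 : c * (n / l) ≤ c * Real.sqrt n := by gcongr
  have h2 : Real.sqrt l ≤ c * Real.sqrt l := le_mul_of_one_le_left (by linarith) hc
  have h3 : Real.sqrt n ≤ c * Real.sqrt n := le_mul_of_one_le_left (by linarith) hc
  rcases hasHomogeneous_or_half_scale hn hl hA (by rw [hcc]; linarith) with h | ⟨A', hA', hcard, himp⟩
  · exact h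
  rw [hcc] at hcard
  have hA'n : Real.sqrt n ≤ A'.card := by linarith
  refine himp (ih (l / 2) (by omega) A' hA' hA'n ?_)
  have hA'l : A'.card ≤ l / 2 := by simpa using Finset.card_le_card hA'
  have hA'lR : (A'.card : ℝ) ≤ (l / 2 : ℕ) := by exact_mod_cast hA'l
  have hhalf : ((l / 2 : ℕ) : ℝ) ≤ l / 2 := Nat.cast_div_le
  have hpos : (0 : ℝ) < (l / 2 : ℕ) := by linarith
  have h4 : Real.sqrt (l / 2 : ℕ) ≤ 3 / 4 * Real.sqrt l := by
    rw [Real.sqrt_le_left (by positivity), mul_pow, Real.sq_sqrt (by linarith)]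
    linarith
  have h5 : 2 * ((n : ℝ) / l) ≤ n / (l / 2 : ℕ) := by
    calc 2 * ((n : ℝ) / l) = n / (l / 2) := by field_simp
      _ ≤ _ := by gcongr
  have h6 : c * Real.sqrt (l / 2 : ℕ) ≤ c * (3 / 4 * Real.sqrt l) := by gcongr
  have h7 : c * (2 * ((n : ℝ) / l)) ≤ c * (n / (l / 2 : ℕ)) := by gcongr
  linarith

end Reduction

end SubsetSumProgression

open SubsetSumProgression in
theorem mainTheorem7 :
    ∃ C : ℝ, 0 < C ∧
      ∀ (n : ℕ) (A : Finset ℕ), A ⊆ Finset.Icc 1 n →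
        C * Real.sqrt (n : ℝ) ≤ (A.card : ℝ) →
          ∃ P : Finset ℕ, IsHomogeneousProgression P n ∧ (P : Set ℕ) ⊆ subsetSums A := by
  have hc : (1 : ℝ) ≤ cost := by norm_num [cost]
  refine ⟨175 * cost, by linarith, fun n A hA hcard => ?_⟩
  rcases Nat.eq_zero_or_pos n with rfl | hn
  · exact ⟨∅, ⟨0, 1, one_pos, one_dvd 0, by simp⟩, by simp⟩
  have hnR : (1 : ℝ) ≤ n := by exact_mod_cast hn
  have h1 : Real.sqrt n ≤ cost * Real.sqrt n := le_mul_of_one_le_left (Real.sqrt_nonneg _) hc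
  have h2 : (n : ℝ) / n = 1 := div_self (by linarith)
  obtain ⟨a, d, hd, hda, h⟩ := hasHomogeneous_of_card hn n A hA
    (by linarith) (by rw [h2]; linarith)
  refine ⟨_, ⟨a, d, hd, hda, rfl⟩, ?_⟩
  intro x hx
  simp only [Finset.coe_image, Set.mem_image, Finset.mem_coe, Finset.mem_range] at hx
  obtain ⟨i, hi, rfl⟩ := hx
  exact h i hi
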